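/- **Theorem 1.** There is a universal constant $C>0$ with the following property. Let $w_1,\dots,w_m$ be distinct complex numbers with $|w_k|=1$. Build a symmetric Leja sequence $(z_n)_{n\ge1}$ on the unit circle: put $z_{2k-1}=w_k$ and $z_{2k}=\overline{w_k}$ for $1\le k\le m$; then, for every $k\ge m$, with $p_{2k}(z)=\prod_{j=1}^{2k}(z-z_j)$, let $z_{2k+1}$ be any point of the unit circle at which $|p_{2k}|$ attains its maximum over the unit circle, and put $z_{2k+2}=\overline{z_{2k+1}}$. Let $x_n\in[0,1]$ be such that $z_n=e^{2\pi i x_n}$, and let $$D_n(x)=\left|\frac1n\#\{1\le k\le n:\ x_k\le x\}-x\right|,\qquad \|D_n\|_{L^1}=\int_0^1 D_n(x)\,dx .$$ Then, for all $N\ge N_0$, where $N_0$ depends only on $w_1,\dots,w_m$, $$\frac1N\sum_{n=1}^{N} n\,\|D_n\|_{L^1}\ \le\ C(\log N)^2 .$$ Moreover, $\|D_n\|_{L^1}\lesssim (\log n)^2/n$ for typical $n$, in the following sense: for every $K>0$ and all $N\ge N_1$, where $N_1$ depends only on $w_1,\dots,w_m$ and $K$, $$\#\Big\{1\le n\le N:\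 \|D_n\|_{L^1}>K\,\frac{(\log n)^2}{n}\Big\}\ \le\ \frac{C}{K}\,N .$$ -/

import Mathlib

open scoped ComplexConjugate

namespace SymmetricLeja

/-- The monic polynomial `∏_{k=1}^n (X - z_k)` whose roots are the first `n` terms of a sequence.
Sequences are indexed from `0`, so the term written `z_k` on paper is `z (k - 1)`. -/
noncomputable def rootPoly (z : ℕ → ℂ) (n : ℕ) : Polynomial ℂ :=
  ∏ k ∈ Finset.range n, (Polynomial.X - Polynomial.C (z k))

/-- `z` is a symmetric Leja sequence started from `w_1, …, w_m`: it begins with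
`w_1, conj w_1, …, w_m, conj w_m`, and from then on, after each even number `2k ≥ 2m` of roots,
a point of the unit circle at which `|p_{2k}|` is maximal (any maximizer is admissible), and then
its complex conjugate, are appended. -/
structure IsSymmetricLejaSequence {m : ℕ} (w : Fin m → ℂ) (z : ℕ → ℂ) : Prop where
  init : ∀ k : Fin m, z (2 * (k : ℕ)) = w k
  greedy_mem : ∀ k : ℕ, m ≤ k → z (2 * k) ∈ Metric.sphere (0 : ℂ) 1
  greedy_max : ∀ k : ℕ, m ≤ k →
    IsMaxOn (fun ζ : ℂ => ‖(rootPoly z (2 * k)).eval ζ‖) (Metric.sphere (0 : ℂ) 1) (z (2 * k))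
  conj_pair : ∀ k : ℕ, z (2 * k + 1) = conj (z (2 * k))

/-- `x` is a sequence in `[0,1]` with `z_k = exp(2 π i x_k)`. -/
def IsAngleSequence (z : ℕ → ℂ) (x : ℕ → ℝ) : Prop :=
  ∀ k : ℕ, x k ∈ Set.Icc (0 : ℝ) 1 ∧
    z k = Complex.exp (2 * (Real.pi : ℂ) * Complex.I * (x k : ℂ))

/-- The discrepancy function `D_N(t) = |#{1 ≤ k ≤ N : x_k ≤ t} / N - t|`. -/
noncomputable def discrepancy (x : ℕ → ℝ) (N : ℕ) (t : ℝ) : ℝ :=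
  |(1 / (N : ℝ)) * (((Finset.range N).filter (fun k => x k ≤ t)).card : ℝ) - t|

/-- The norm of `D_N` in `L¹([0,1])`. -/
noncomputable def discrepancyL1 (x : ℕ → ℝ) (N : ℕ) : ℝ :=
  ∫ t in (0 : ℝ)..1, |discrepancy x N t|

end SymmetricLeja

/-! The scaled discrepancy `n * D_n` is essentially `|∑ sawtooth (t - x_j)|`, and this sum is `-1/π`
times the boundary argument of `∏ (1 - z conj z_j)`, the harmonic conjugate of `log |p_n|`. Since
`log |p_n|` has mean zero on the circle, its `L¹` norm is at most twice the log of the maximum of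
`|p_n|`. Conjugation is not bounded on `L¹`, but at radius about `1 - 1/n` the conjugate Poisson
kernel has `L¹` norm `O(log n)`, and moving to that radius costs only `O(log n)` in total. Hence `n
* ‖D_n‖ ≲ (log max |p_n| + 1) * log n` (`integral_abs_sum_sawtooth_le`).

The greedy choice is used only on average. With `y_k = 2 Re z_{2k}`, the maximum of `|p_{2k}|` is
`∏_{j<k} |y_k - y_j|`, so the product of the maxima over `k < N` is a Vandermonde determinant of
points of `[-2, 2]`. Written in Chebyshev columns it is at most `N! 2^N` (`prod_norm_sub_le`), so
the logs of the maxima sum to at most `N log N + O(N)`. This supplies the second logarithm; Markov's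
inequality then gives the statement on typical `n`. -/

namespace SymmetricLeja

/-! ### Chebyshev columns and the Vandermonde bound -/

lemma chebyshevC_natDegree_monic (n : ℕ) :
    (Polynomial.Chebyshev.C ℂ ((n : ℤ) + 1)).natDegree = n + 1 ∧
      (Polynomial.Chebyshev.C ℂ ((n : ℤ) + 1)).Monic := by
  induction n using Nat.strong_induction_on with
  | _ n ih =>
    match n with
    | 0 => simp [Polynomial.Chebyshev.C_one, Polynomial.monic_X]
    | 1 =>
      have h : (Polynomial.Chebyshev.C ℂ (((1 : ℕ) : ℤ) + 1)) =
          Polynomial.X ^ 2 - Polynomial.C 2 := by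
        have := Polynomial.Chebyshev.C_two ℂ
        norm_num at this ⊢
        exact this
      rw [h]
      exact ⟨Polynomial.natDegree_X_pow_sub_C, Polynomial.monic_X_pow_sub_C _ (by norm_num)⟩
    | n + 2 =>
      obtain ⟨h1, h2⟩ := ih n (by omega)
      obtain ⟨h3, h4⟩ := ih (n + 1) (by omega)
      have h : Polynomial.Chebyshev.C ℂ (((n + 2 : ℕ) : ℤ) + 1) =
          Polynomial.X * Polynomial.Chebyshev.C ℂ (((n + 1 : ℕ) : ℤ) + 1) -
            Polynomial.Chebyshev.C ℂ ((n : ℤ) + 1) := by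
        have := Polynomial.Chebyshev.C_add_two ℂ ((n : ℤ) + 1)
        push_cast
        convert this using 2; ring_nf
      have hm := Polynomial.monic_X.mul h4
      have hd : (Polynomial.X * Polynomial.Chebyshev.C ℂ (((n + 1 : ℕ) : ℤ) + 1)).natDegree
          = n + 3 := by
        rw [Polynomial.monic_X.natDegree_mul h4, h3, Polynomial.natDegree_X]; ring
      have hlt : (Polynomial.Chebyshev.C ℂ ((n : ℤ) + 1)).degree <
          (Polynomial.X * Polynomial.Chebyshev.C ℂ (((n + 1 : ℕ) : ℤ) + 1)).degree := by
        apply Polynomial.degree_lt_degree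
        rw [h1, hd]; omega
      rw [h]
      refine ⟨?_, hm.sub_of_left hlt⟩
      rw [Polynomial.natDegree_eq_of_degree_eq (Polynomial.degree_sub_eq_left_of_degree_lt hlt), hd]

/-- This normalisation of Chebyshev polynomials is both monic in positive degree and bounded by 2 on
`[-2, 2]`, which is what the determinant estimate needs. -/
lemma chebyshevC_eval_add_inv (n : ℕ) {z : ℂ} (hz : z ≠ 0) :
    (Polynomial.Chebyshev.C ℂ (n : ℤ)).eval (z + z⁻¹) = z ^ n + z⁻¹ ^ n := by
  induction n using Nat.strong_induction_on with
  | _ n ih =>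
    match n with
    | 0 => simp; norm_num
    | 1 => simp
    | n + 2 =>
      have h1 := ih n (by omega)
      have h2 := ih (n + 1) (by omega)
      have h := Polynomial.Chebyshev.C_add_two ℂ (n : ℤ)
      push_cast at h2 ⊢
      rw [h, Polynomial.eval_sub, Polynomial.eval_mul, Polynomial.eval_X, h1, h2]
      linear_combination (z ^ n + z⁻¹ ^ n) * mul_inv_cancel₀ hz

lemma fin_prod_Ioi_eq_prod_range {M : Type*} [CommMonoid M] (n : ℕ) (f : ℕ → ℕ → M) :
    ∏ i : Fin n, ∏ j ∈ Finset.Ioi i, f i j =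
      ∏ k ∈ Finset.range n, ∏ j ∈ Finset.range k, f j k := by
  rw [Finset.prod_comm' (t' := Finset.univ) (s' := fun j => Finset.Iio j) (by simp),
    ← Fin.prod_univ_eq_prod_range (fun k => ∏ j ∈ Finset.range k, f j k)]
  refine Finset.prod_congr rfl fun j _ => ?_
  have : Finset.range (j : ℕ) = (Finset.Iio j).map Fin.valEmbedding := by
    rw [Fin.map_valEmbedding_Iio]; ext; simp
  rw [this, Finset.prod_map]
  rfl

/-- Upper bound for the discriminant of points of `[-2, 2]`, parametrised by the unit circle. -/
lemma prod_norm_sub_le (z : ℕ → ℂ) (hz : ∀ k, ‖z k‖ = 1) (n : ℕ) :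
    ∏ k ∈ Finset.range n, ∏ j ∈ Finset.range k,
      ‖(z k + conj (z k)) - (z j + conj (z j))‖ ≤ (n.factorial : ℝ) * 2 ^ n := by
  set y : ℕ → ℂ := fun k => z k + conj (z k) with hy
  have hinv : ∀ k, conj (z k) = (z k)⁻¹ := fun k => (Complex.inv_eq_conj (hz k)).symm
  have hne : ∀ k, z k ≠ 0 := fun k h => by simpa [h] using hz k
  -- `C_0 = 2` is not monic, so the column of degree 0 is replaced by the constant 1.
  let p : Fin n → Polynomial ℂ := fun i =>
    if (i : ℕ) = 0 then 1 else Polynomial.Chebyshev.C ℂ ((i : ℕ) : ℤ)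
  have hp : ∀ i, (p i).natDegree = i ∧ (p i).Monic := by
    intro i
    simp only [p]
    split_ifs with h
    · simp [h]
    · obtain ⟨k, hk⟩ := Nat.exists_eq_succ_of_ne_zero h
      have := chebyshevC_natDegree_monic k
      rw [hk]; push_cast; simpa using this
  have hdet := Matrix.det_eval_matrixOfPolynomials_eq_det_vandermonde
    (fun i : Fin n => y i) p (fun i => (hp i).1) (fun i => (hp i).2)
  have hle : ‖(Matrix.vandermonde (fun i : Fin n => y i)).det‖ ≤ (n.factorial : ℝ) * 2 ^ n := by
    rw [hdet]
    -- Leibniz expansion: `n!` terms, each a product of `n` entries of modulus at most 2. Hadamard's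
    -- inequality would be sharper, but only `n log n + O(n)` is needed after taking logs.
    have := Matrix.det_le (abv := (NormedField.toAbsoluteValue ℂ)) (x := (2 : ℝ))
      (A := Matrix.of fun i j : Fin n => (p j).eval (y i)) ?_
    · rw [Fintype.card_fin, nsmul_eq_mul] at this
      exact this
    · intro i j
      change ‖(p j).eval (y i)‖ ≤ 2
      simp only [p]
      split_ifs with h
      · simp
      · rw [hy]
        simp only [hinv]
        rw [chebyshevC_eval_add_inv _ (hne _)]
        refine (norm_add_le _ _).trans ?_
        simp only [norm_pow, norm_inv, hz, inv_one, one_pow]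
        norm_num
  rw [Matrix.det_vandermonde, norm_prod] at hle
  simp only [norm_prod] at hle
  rwa [fin_prod_Ioi_eq_prod_range n (fun i j => ‖y j - y i‖)] at hle

/-! ### Circle averages and the Schwarz formula -/

open Real in
/-- The point of the unit circle with angle `2πt`. -/
noncomputable def circlePoint (t : ℝ) : ℂ := Complex.exp (2 * (π : ℂ) * Complex.I * (t : ℂ))

open Real in
lemma circlePoint_eq (t : ℝ) :
    circlePoint t = (cos (2 * π * t) : ℂ) + (sin (2 * π * t) : ℂ) * Complex.I := by
  rw [circlePoint, show 2 * (π : ℂ) * Complex.I * (t : ℂ) = ((2 * π * t : ℝ) : ℂ) * Complex.I by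
    push_cast; ring, Complex.exp_mul_I]
  push_cast; rfl

@[simp] lemma norm_circlePoint (t : ℝ) : ‖circlePoint t‖ = 1 := by
  rw [circlePoint, show 2 * (Real.pi : ℂ) * Complex.I * (t : ℂ) =
    ((2 * Real.pi * t : ℝ) : ℂ) * Complex.I by push_cast; ring, Complex.norm_exp_ofReal_mul_I]

lemma circlePoint_mul_conj (s t : ℝ) :
    circlePoint s * conj (circlePoint t) = circlePoint (s - t) := by
  rw [circlePoint, circlePoint, circlePoint, ← Complex.exp_conj, ← Complex.exp_add]
  congr 1
  simp only [map_mul, map_ofNat, Complex.conj_ofReal, Complex.conj_I]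
  push_cast
  ring

lemma circlePoint_periodic : Function.Periodic circlePoint 1 := by
  intro t
  rw [circlePoint_eq, circlePoint_eq, mul_add, mul_one, Real.cos_add_two_pi, Real.sin_add_two_pi]

lemma continuous_circlePoint : Continuous circlePoint := by
  unfold circlePoint; fun_prop

lemma circleAverage_eq_integral_circlePoint {E : Type*} [NormedAddCommGroup E] [NormedSpace ℝ E]
    (f : ℂ → E) (r : ℝ) :
    Real.circleAverage f 0 r = ∫ t in (0 : ℝ)..1, f (r * circlePoint t) := by
  have h := intervalIntegral.smul_integral_comp_mul_left (a := 0) (b := 1)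
    (fun θ => f (circleMap 0 r θ)) (2 * Real.pi)
  rw [Real.circleAverage, mul_zero, mul_one] at *
  rw [← h, smul_smul, inv_mul_cancel₀ (by positivity), one_smul]
  refine intervalIntegral.integral_congr fun t _ => ?_
  simp only [circleMap, circlePoint]
  congr 2
  push_cast; ring_nf

/-- Schwarz' integral formula for a function vanishing at the centre of the disc. -/
lemma eq_circleAverage_re_mul {F : ℂ → ℂ} {r : ℝ} (hr : 0 < r)
    (hF : DiffContOnCl ℂ F (Metric.ball 0 r)) (h0 : F 0 = 0) {w : ℂ} (hw : ‖w‖ < r) :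
    F w = Real.circleAverage (fun z => ((2 * (F z).re : ℝ) : ℂ) * (z / (z - w))) 0 r := by
  have habs : |r| = r := abs_of_pos hr
  have hcont : ContinuousOn F (Metric.sphere 0 |r|) := by
    rw [habs]
    exact hF.continuousOn_ball.mono Metric.sphere_subset_closedBall
  have hden : ∀ z ∈ Metric.sphere (0 : ℂ) |r|, z - w ≠ 0 := by
    intro z hz h
    rw [habs, mem_sphere_zero_iff_norm] at hz
    rw [sub_eq_zero.1 h] at hz
    exact hw.ne hz
  have h1 : Real.circleAverage (fun z => (z / (z - w)) * F z) 0 r = F w := by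
    have := DiffContOnCl.circleAverage_smul_div (f := F) (c := 0) (R := r) (w := w)
      (by rwa [habs]) (by simpa [habs] using hw)
    simpa using this
  have hden' : ∀ z ∈ Metric.closedBall (0 : ℂ) r, (r : ℂ) ^ 2 - z * conj w ≠ 0 := by
    intro z hz h
    have h2 : (r : ℂ) ^ 2 = z * conj w := sub_eq_zero.1 h
    have h3 : r ^ 2 = ‖z‖ * ‖w‖ := by
      have := congrArg norm h2
      simpa [abs_of_pos hr] using this
    have hz' : ‖z‖ ≤ r := by simpa using hz
    nlinarith [norm_nonneg z, norm_nonneg w]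
  -- The pole of this kernel is the reflection of `w` in the circle, hence outside the disc, so the
  -- mean value property gives the value at 0.
  have h2 : Real.circleAverage (fun z => ((r : ℂ) ^ 2 / ((r : ℂ) ^ 2 - z * conj w)) * F z) 0 r
      = 0 := by
    have hd : DiffContOnCl ℂ (fun z => ((r : ℂ) ^ 2 / ((r : ℂ) ^ 2 - z * conj w)) * F z)
        (Metric.ball 0 |r|) := by
      rw [habs]
      have : DifferentiableOn ℂ (fun z => ((r : ℂ) ^ 2 / ((r : ℂ) ^ 2 - z * conj w)))
          (Metric.closedBall 0 r) := by
        apply DifferentiableOn.div (by fun_prop) (by fun_prop) hden'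
      exact (DifferentiableOn.diffContOnCl (by rwa [closure_ball _ hr.ne'])).smul hF
    rw [DiffContOnCl.circleAverage hd, h0, mul_zero]
  -- On the circle `z * conj z = r ^ 2`, so this integrand is the conjugate of the previous one.
  -- Adding it to Cauchy's formula turns `F` into `2 Re F`.
  have h3 : Real.circleAverage (fun z => (z / (z - w)) * conj (F z)) 0 r = 0 := by
    have h4 : Real.circleAverage (fun z => (z / (z - w)) * conj (F z)) 0 r =
        Real.circleAverage
          (Complex.conjCLE ∘ (fun z => ((r : ℂ) ^ 2 / ((r : ℂ) ^ 2 - z * conj w)) * F z)) 0 r := by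
      refine Real.circleAverage_congr_sphere fun z hz => ?_
      have hz0 : z - w ≠ 0 := hden z hz
      rw [habs] at hz
      have hzn : ‖z‖ = r := by simpa using hz
      have hzz : z * conj z = (r : ℂ) ^ 2 := by
        rw [Complex.mul_conj, Complex.normSq_eq_norm_sq, hzn]; push_cast; rfl
      have hcz : conj z ≠ 0 := by
        rw [Ne, map_eq_zero, ← norm_eq_zero, hzn]; exact hr.ne'
      simp only [Function.comp, Complex.conjCLE_apply, map_mul, map_div₀, map_sub, map_pow,
        Complex.conj_ofReal, Complex.conj_conj]
      congr 1
      rw [← hzz, show z * conj z - conj z * w = conj z * (z - w) by ring,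
        mul_comm z, mul_div_mul_left _ _ hcz]
    rw [h4, show (Complex.conjCLE ∘ (fun z => ((r : ℂ) ^ 2 / ((r : ℂ) ^ 2 - z * conj w)) * F z)) =
      ((Complex.conjCLE : ℂ →L[ℝ] ℂ) ∘
        (fun z => ((r : ℂ) ^ 2 / ((r : ℂ) ^ 2 - z * conj w)) * F z)) from rfl,
      ContinuousLinearMap.circleAverage_comp_comm _, h2, map_zero]
    refine ContinuousOn.circleIntegrable hr.le ?_
    refine ContinuousOn.mul (ContinuousOn.div (by fun_prop) (by fun_prop) fun z hz => ?_)
      (by rwa [habs] at hcont)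
    exact hden' z (Metric.sphere_subset_closedBall hz)
  have hq : ContinuousOn (fun z => z / (z - w)) (Metric.sphere 0 |r|) :=
    ContinuousOn.div (by fun_prop) (by fun_prop) hden
  rw [show F w = Real.circleAverage (fun z => (z / (z - w)) * F z) 0 r +
    Real.circleAverage (fun z => (z / (z - w)) * conj (F z)) 0 r by rw [h1, h3, add_zero],
    ← Real.circleAverage_add]
  · refine Real.circleAverage_congr_sphere fun z _ => ?_
    simp only [Pi.add_apply]
    rw [← mul_add, Complex.add_conj, mul_comm]
  · exact (hq.mul hcont).circleIntegrable'
  · exact (hq.mul (Complex.continuous_conj.comp_continuousOn hcont)).circleIntegrable'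

lemma one_sub_smul_circlePoint_ne_zero {ρ : ℝ} (h0 : 0 ≤ ρ) (h1 : ρ < 1) (t : ℝ) :
    1 - (ρ : ℂ) * circlePoint t ≠ 0 := by
  intro h
  have h2 : ‖(ρ : ℂ) * circlePoint t‖ = 1 := by rw [← sub_eq_zero.1 h, norm_one]
  rw [norm_mul, norm_circlePoint, Complex.norm_real, Real.norm_of_nonneg h0, mul_one] at h2
  exact h1.ne h2

/-! ### `L¹` bounds for the harmonic conjugate -/

/-- Half of the conjugate Poisson kernel of the unit disc. -/
noncomputable def conjKernel (ρ t : ℝ) : ℝ := ((1 - (ρ : ℂ) * circlePoint t)⁻¹).im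

lemma continuous_conjKernel {ρ : ℝ} (h0 : 0 ≤ ρ) (h1 : ρ < 1) : Continuous (conjKernel ρ) := by
  have := continuous_circlePoint
  exact Complex.continuous_im.comp
    (Continuous.inv₀ (by fun_prop) (one_sub_smul_circlePoint_ne_zero h0 h1))

lemma conjKernel_periodic (ρ : ℝ) : Function.Periodic (conjKernel ρ) 1 := by
  intro t; rw [conjKernel, circlePoint_periodic, conjKernel]

lemma conjKernel_eq (ρ t : ℝ) :
    conjKernel ρ t = ρ * Real.sin (2 * Real.pi * t) /
      (1 - 2 * ρ * Real.cos (2 * Real.pi * t) + ρ ^ 2) := by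
  have h : Complex.normSq (1 - (ρ : ℂ) * circlePoint t) =
      1 - 2 * ρ * Real.cos (2 * Real.pi * t) + ρ ^ 2 := by
    rw [circlePoint_eq, Complex.normSq_apply]
    simp only [Complex.sub_re, Complex.one_re, Complex.mul_re, Complex.ofReal_re, Complex.add_re,
      Complex.I_re, Complex.I_im, Complex.ofReal_im, Complex.sub_im, Complex.one_im,
      Complex.mul_im, Complex.add_im]
    linear_combination (ρ ^ 2) * Real.sin_sq_add_cos_sq (2 * Real.pi * t)
  rw [conjKernel, Complex.inv_im, h]
  congr 1
  rw [circlePoint_eq]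
  simp only [Complex.sub_im, Complex.one_im, Complex.mul_im, Complex.ofReal_re, Complex.add_im,
    Complex.ofReal_im, Complex.I_im, Complex.I_re]
  ring

/-- The kernel is odd about `1/2`, nonnegative on `[0, 1/2]`, and has the log of its denominator,
over `4π`, as a primitive. The growth as `ρ → 1` is the source of one logarithm in the theorem. -/
lemma integral_abs_conjKernel {ρ : ℝ} (h0 : 0 ≤ ρ) (h1 : ρ < 1) :
    ∫ t in (0 : ℝ)..1, |conjKernel ρ t| = Real.log ((1 + ρ) / (1 - ρ)) / Real.pi := by
  have hpi := Real.pi_pos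
  have hden : ∀ t : ℝ, 0 < 1 - 2 * ρ * Real.cos (2 * Real.pi * t) + ρ ^ 2 := by
    intro t
    have := Real.cos_le_one (2 * Real.pi * t)
    nlinarith [mul_nonneg h0 (sub_nonneg.2 this)]
  have hcont := continuous_conjKernel h0 h1
  have hhalf : ∫ t in (0 : ℝ)..(1 / 2), conjKernel ρ t =
      Real.log ((1 + ρ) / (1 - ρ)) / (2 * Real.pi) := by
    rw [intervalIntegral.integral_eq_sub_of_hasDerivAt (f := fun t =>
      Real.log (1 - 2 * ρ * Real.cos (2 * Real.pi * t) + ρ ^ 2) / (4 * Real.pi)) (f' := conjKernel ρ)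
      (fun t _ => ?_) (hcont.intervalIntegrable _ _)]
    · rw [show 2 * Real.pi * (1 / 2) = Real.pi by ring, Real.cos_pi, mul_zero, Real.cos_zero,
        show 1 - 2 * ρ * -1 + ρ ^ 2 = (1 + ρ) ^ 2 by ring,
        show 1 - 2 * ρ * 1 + ρ ^ 2 = (1 - ρ) ^ 2 by ring, Real.log_pow, Real.log_pow,
        Real.log_div (by linarith) (by linarith)]
      field_simp
      push_cast
      ring
    · have hd : HasDerivAt (fun t : ℝ => 1 - 2 * ρ * Real.cos (2 * Real.pi * t) + ρ ^ 2)
          (2 * ρ * (Real.sin (2 * Real.pi * t) * (2 * Real.pi))) t := by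
        have h2 : HasDerivAt (fun t : ℝ => 2 * Real.pi * t) (2 * Real.pi) t := by
          simpa using (hasDerivAt_id t).const_mul (2 * Real.pi)
        have h3 := ((h2.cos.const_mul (2 * ρ)).const_sub 1).add_const (ρ ^ 2)
        refine h3.congr_deriv ?_
        ring
      refine ((hd.log (hden t).ne').div_const (4 * Real.pi)).congr_deriv ?_
      rw [conjKernel_eq]
      have := (hden t).ne'
      field_simp
      ring
  have h2 : ∫ t in (0 : ℝ)..(1 / 2), |conjKernel ρ t| = ∫ t in (0 : ℝ)..(1 / 2), conjKernel ρ t := by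
    refine intervalIntegral.integral_congr fun t ht => abs_of_nonneg ?_
    rw [Set.uIcc_of_le (by norm_num)] at ht
    rw [conjKernel_eq]
    refine div_nonneg (mul_nonneg h0 (Real.sin_nonneg_of_nonneg_of_le_pi ?_ ?_)) (hden t).le
    · have := ht.1; positivity
    · nlinarith [ht.2]
  have h3 : ∫ t in (1 / 2 : ℝ)..1, |conjKernel ρ t| = ∫ t in (0 : ℝ)..(1 / 2), |conjKernel ρ t| := by
    have := intervalIntegral.integral_comp_sub_left (a := 0) (b := 1 / 2)
      (fun t => |conjKernel ρ t|) 1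
    norm_num at this
    rw [← this]
    refine intervalIntegral.integral_congr fun t _ => ?_
    simp only [conjKernel_eq]
    rw [show 2 * Real.pi * (1 - t) = 2 * Real.pi - 2 * Real.pi * t by ring, Real.cos_two_pi_sub,
      Real.sin_two_pi_sub, mul_neg, neg_div, abs_neg]
  rw [← intervalIntegral.integral_add_adjacent_intervals (b := 1 / 2)
    (hcont.abs.intervalIntegrable _ _) (hcont.abs.intervalIntegrable _ _), h3, h2, hhalf]
  field_simp
  ring

lemma im_eq_integral_conjKernel {F : ℂ → ℂ} (hF : DifferentiableOn ℂ F (Metric.ball 0 1))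
    (h0 : F 0 = 0) {r ρ : ℝ} (hr0 : 0 < r) (hr1 : r < 1) (hρ0 : 0 ≤ ρ) (hρ1 : ρ < 1) (t : ℝ) :
    (F ((ρ * r : ℝ) * circlePoint t)).im =
      ∫ s in (0 : ℝ)..1, (2 * (F (r * circlePoint s)).re) * conjKernel ρ (t - s) := by
  have hsub : Metric.closedBall (0 : ℂ) r ⊆ Metric.ball 0 1 := Metric.closedBall_subset_ball hr1
  have hcl : DiffContOnCl ℂ F (Metric.ball 0 r) :=
    DifferentiableOn.diffContOnCl (by rw [closure_ball _ hr0.ne']; exact hF.mono hsub)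
  have hmem : ∀ s, (r : ℂ) * circlePoint s ∈ Metric.ball (0 : ℂ) 1 := fun s => by
    simpa [abs_of_pos hr0] using hr1
  have hc := continuous_circlePoint
  have hFc : Continuous fun s => F (r * circlePoint s) :=
    hF.continuousOn.comp_continuous (by fun_prop) hmem
  rw [eq_circleAverage_re_mul hr0 hcl h0 (w := (ρ * r : ℝ) * circlePoint t),
    circleAverage_eq_integral_circlePoint]
  · have hk : ∀ s, (r * circlePoint s) / (r * circlePoint s - (ρ * r : ℝ) * circlePoint t) =
        (1 - (ρ : ℂ) * circlePoint (t - s))⁻¹ := by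
      intro s
      have h1 : circlePoint s * conj (circlePoint s) = 1 := by
        rw [Complex.mul_conj, Complex.normSq_eq_norm_sq]; simp
      have h2 : (r : ℂ) * circlePoint s ≠ 0 := by
        intro h; have := congrArg norm h; simp [hr0.ne'] at this
      have h3 : r * circlePoint s - (ρ * r : ℝ) * circlePoint t =
          r * circlePoint s * (1 - (ρ : ℂ) * circlePoint (t - s)) := by
        rw [← circlePoint_mul_conj]
        push_cast
        linear_combination (-(r : ℂ) * ρ * circlePoint t) * (-h1)
      rw [h3, div_mul_eq_div_div, div_self h2, one_div]
    simp only [hk]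
    have hne := one_sub_smul_circlePoint_ne_zero hρ0 hρ1
    have hint : Continuous fun s => ((2 * (F (r * circlePoint s)).re : ℝ) : ℂ) *
        (1 - (ρ : ℂ) * circlePoint (t - s))⁻¹ := by
      refine Continuous.mul (Complex.continuous_ofReal.comp
        (continuous_const.mul (Complex.continuous_re.comp hFc)))
        (Continuous.inv₀ (by fun_prop) fun s => hne _)
    have := Complex.imCLM.intervalIntegral_comp_comm (μ := MeasureTheory.volume)
      (hint.intervalIntegrable 0 1)
    simp only [Complex.imCLM_apply, Complex.im_ofReal_mul] at this
    rw [← this]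
    rfl
  · rw [norm_mul, norm_circlePoint, Complex.norm_real, Real.norm_of_nonneg (by positivity), mul_one]
    nlinarith

/-- Young's inequality for the convolution with the conjugate kernel. Two radii appear because `F`
is only controlled inside the open disc. -/
lemma integral_abs_im_le {F : ℂ → ℂ} (hF : DifferentiableOn ℂ F (Metric.ball 0 1))
    (h0 : F 0 = 0) {r ρ : ℝ} (hr0 : 0 < r) (hr1 : r < 1) (hρ0 : 0 ≤ ρ) (hρ1 : ρ < 1) :
    ∫ t in (0 : ℝ)..1, |(F ((ρ * r : ℝ) * circlePoint t)).im| ≤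
      2 * (∫ s in (0 : ℝ)..1, |(F (r * circlePoint s)).re|) *
        (Real.log ((1 + ρ) / (1 - ρ)) / Real.pi) := by
  have hc := continuous_circlePoint
  have hmem : ∀ R : ℝ, 0 ≤ R → R < 1 → ∀ s, (R : ℂ) * circlePoint s ∈ Metric.ball (0 : ℂ) 1 :=
    fun R hR hR1 s => by simpa [abs_of_nonneg hR] using hR1
  have hFc : ∀ R : ℝ, 0 ≤ R → R < 1 → Continuous fun s => F (R * circlePoint s) :=
    fun R hR hR1 => hF.continuousOn.comp_continuous (by fun_prop) (hmem R hR hR1)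
  have hre := (Complex.continuous_re.comp (hFc r hr0.le hr1)).abs
  have hk := (continuous_conjKernel hρ0 hρ1)
  simp only [Function.comp_def] at hre
  have hj : Continuous fun p : ℝ × ℝ =>
      2 * |(F (r * circlePoint p.2)).re| * |conjKernel ρ (p.1 - p.2)| :=
    ((hre.comp continuous_snd).const_mul 2).mul
      (hk.abs.comp (continuous_fst.sub continuous_snd))
  have hR : ρ * r < 1 := by nlinarith
  calc ∫ t in (0 : ℝ)..1, |(F ((ρ * r : ℝ) * circlePoint t)).im|
      ≤ ∫ t in (0 : ℝ)..1, ∫ s in (0 : ℝ)..1,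
          2 * |(F (r * circlePoint s)).re| * |conjKernel ρ (t - s)| := by
        refine intervalIntegral.integral_mono_on zero_le_one ?_ ?_ fun t _ => ?_
        · exact (Complex.continuous_im.comp
            (hFc (ρ * r) (by positivity) hR)).abs.intervalIntegrable _ _
        · exact (intervalIntegral.continuous_parametric_intervalIntegral_of_continuous'
            hj 0 1).intervalIntegrable _ _
        · rw [im_eq_integral_conjKernel hF h0 hr0 hr1 hρ0 hρ1 t]
          refine (intervalIntegral.abs_integral_le_integral_abs zero_le_one).trans_eq ?_
          simp only [abs_mul, abs_two]
    _ = ∫ s in (0 : ℝ)..1, ∫ t in (0 : ℝ)..1,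
          2 * |(F (r * circlePoint s)).re| * |conjKernel ρ (t - s)| := by
        simp only [intervalIntegral.integral_of_le zero_le_one]
        refine MeasureTheory.integral_integral_swap ?_
        rw [MeasureTheory.Measure.prod_restrict]
        exact (hj.continuousOn.integrableOn_compact
          (isCompact_Icc.prod isCompact_Icc)).mono_set
          (Set.prod_mono Set.Ioc_subset_Icc_self Set.Ioc_subset_Icc_self)
    _ = ∫ s in (0 : ℝ)..1, 2 * |(F (r * circlePoint s)).re| *
          (Real.log ((1 + ρ) / (1 - ρ)) / Real.pi) := by
        refine intervalIntegral.integral_congr fun s _ => ?_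
        rw [intervalIntegral.integral_const_mul, ← integral_abs_conjKernel hρ0 hρ1,
          intervalIntegral.integral_comp_sub_right (fun t => |conjKernel ρ t|)]
        have hp : Function.Periodic (fun t => |conjKernel ρ t|) 1 := fun t => by
          change |_| = |_|; rw [conjKernel_periodic ρ t]
        have := hp.intervalIntegral_add_eq (0 - s) 0
        rw [zero_add, show 0 - s + 1 = 1 - s by ring] at this
        rw [this]
    _ = _ := by
        rw [intervalIntegral.integral_mul_const, intervalIntegral.integral_const_mul]

/-- An upper bound alone suffices: `Re F` has mean zero and `|u| ≤ 2M - u` whenever `u ≤ M` and `0 ≤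
M`. -/
lemma integral_abs_re_le {F : ℂ → ℂ} (hF : DifferentiableOn ℂ F (Metric.ball 0 1))
    (h0 : F 0 = 0) {M : ℝ} (hM0 : 0 ≤ M) (hM : ∀ z ∈ Metric.ball (0 : ℂ) 1, (F z).re ≤ M)
    {r : ℝ} (hr0 : 0 < r) (hr1 : r < 1) :
    ∫ s in (0 : ℝ)..1, |(F (r * circlePoint s)).re| ≤ 2 * M := by
  have hc := continuous_circlePoint
  have hmem : ∀ s, (r : ℂ) * circlePoint s ∈ Metric.ball (0 : ℂ) 1 := fun s => by
    simpa [abs_of_pos hr0] using hr1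
  have hFc : Continuous fun s => F (r * circlePoint s) :=
    hF.continuousOn.comp_continuous (by fun_prop) hmem
  have hcl : DiffContOnCl ℂ F (Metric.ball 0 r) :=
    DifferentiableOn.diffContOnCl (by
      rw [closure_ball _ hr0.ne']; exact hF.mono (Metric.closedBall_subset_ball hr1))
  have hmean : ∫ s in (0 : ℝ)..1, (F (r * circlePoint s)).re = 0 := by
    have h1 := DiffContOnCl.circleAverage (f := F) (c := 0) (R := r) (by rwa [abs_of_pos hr0])
    rw [circleAverage_eq_integral_circlePoint, h0] at h1
    have := Complex.reCLM.intervalIntegral_comp_comm (μ := MeasureTheory.volume)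
      (hFc.intervalIntegrable 0 1)
    simp only [Complex.reCLM_apply, h1, Complex.zero_re] at this
    exact this
  have hre : Continuous fun s => (F (r * circlePoint s)).re := Complex.continuous_re.comp hFc
  calc ∫ s in (0 : ℝ)..1, |(F (r * circlePoint s)).re|
      ≤ ∫ s in (0 : ℝ)..1, (2 * M - (F (r * circlePoint s)).re) := by
        refine intervalIntegral.integral_mono_on zero_le_one (hre.abs.intervalIntegrable _ _)
          ((continuous_const.sub hre).intervalIntegrable _ _) fun s _ => ?_
        have := hM _ (hmem s)
        rw [abs_le]; constructor <;> linarith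
    _ = 2 * M := by
        rw [intervalIntegral.integral_sub (by simp) (hre.intervalIntegrable _ _), hmean]
        simp

/-! ### The argument of `1 - R e^{2πit}` against the sawtooth -/

/-- Merges `|arg| ≤ tan |arg| ≤ b / a` with the trivial `|arg| ≤ π / 2 ≤ 2` into one bound that
stays integrable as `a → 0`. -/
lemma abs_arg_le_of_re_pos {w : ℂ} (hre : 0 < w.re) {a b : ℝ} (hb : 0 ≤ b) (ha : 0 < a)
    (h : a * |w.im| ≤ b * w.re) : |w.arg| ≤ 4 * b / (b + a) := by
  have h1 : |w.arg| < Real.pi / 2 := Complex.abs_arg_lt_pi_div_two_iff.2 (Or.inl hre)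
  have h2 : |w.arg| ≤ |w.im| / w.re := by
    have h3 := Real.le_tan (abs_nonneg _) h1
    have h4 : Real.tan |w.arg| = |w.im| / w.re := by
      have := Complex.tan_arg w
      rcases abs_cases w.arg with ⟨h5, h6⟩ | ⟨h5, h6⟩
      · rw [h5, this, abs_of_nonneg (Complex.arg_nonneg_iff.1 h6)]
      · rw [h5, Real.tan_neg, this, abs_of_neg (Complex.arg_neg_iff.1 h6), neg_div]
    rwa [h4] at h3
  have h3 : |w.arg| ≤ b / a := by
    refine h2.trans ?_
    rw [div_le_div_iff₀ hre ha]
    linarith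
  have h4 : |w.arg| ≤ 2 := by linarith [Real.pi_le_four]
  rw [le_div_iff₀ (by linarith)]
  rw [le_div_iff₀ ha] at h3
  nlinarith [abs_nonneg w.arg]

/-- Factoring out `e^{iπ(t - 1/2)}`, the argument on the boundary circle, leaves `(1 + R) sin πt + i
(1 - R) cos πt`, which is nearly real away from the endpoints. -/
lemma abs_arg_one_sub_add_le {R δ t : ℝ} (hR0 : 0 ≤ R) (hR1 : R < 1) (hδ : 1 - R ≤ δ)
    (ht0 : 0 < t) (ht1 : t < 1) :
    |(1 - (R : ℂ) * circlePoint t).arg + Real.pi * (1 / 2 - t)| ≤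
      4 * δ / (δ + t) + 4 * δ / (δ + (1 - t)) := by
  have hpi := Real.pi_pos
  have hδ0 : 0 < δ := by linarith
  set w : ℂ := ⟨(1 + R) * Real.sin (Real.pi * t), (1 - R) * Real.cos (Real.pi * t)⟩ with hw
  have hsin : 0 < Real.sin (Real.pi * t) := Real.sin_pos_of_pos_of_lt_pi (by positivity)
    (by nlinarith)
  have hre : 0 < w.re := by simp only [hw]; positivity
  have hmul : 1 - (R : ℂ) * circlePoint t =
      Complex.exp ((Real.pi * (t - 1 / 2) : ℝ) * Complex.I) * w := by
    have h1 : Real.cos (Real.pi * (t - 1 / 2)) = Real.sin (Real.pi * t) := by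
      rw [mul_sub, mul_one_div, Real.cos_sub_pi_div_two]
    have h2 : Real.sin (Real.pi * (t - 1 / 2)) = -Real.cos (Real.pi * t) := by
      rw [mul_sub, mul_one_div, Real.sin_sub_pi_div_two]
    rw [Complex.exp_mul_I, ← Complex.ofReal_cos, ← Complex.ofReal_sin, h1, h2, circlePoint_eq,
      show 2 * Real.pi * t = 2 * (Real.pi * t) by ring, Real.cos_two_mul, Real.sin_two_mul]
    have h3 := Real.sin_sq_add_cos_sq (Real.pi * t)
    apply Complex.ext
    · simp [hw, -Complex.ofReal_sin, -Complex.ofReal_cos]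
      norm_cast
      linear_combination -(1 + R) * h3
    · simp [hw, -Complex.ofReal_sin, -Complex.ofReal_cos]
      norm_cast
      ring
  have hargw : |w.arg| < Real.pi / 2 := Complex.abs_arg_lt_pi_div_two_iff.2 (Or.inl hre)
  have harge : (Complex.exp ((Real.pi * (t - 1 / 2) : ℝ) * Complex.I)).arg =
      Real.pi * (t - 1 / 2) := by
    rw [Complex.arg_exp_mul_I, toIocMod_eq_self]
    constructor <;> nlinarith
  have harg : (1 - (R : ℂ) * circlePoint t).arg = Real.pi * (t - 1 / 2) + w.arg := by
    rw [hmul, Complex.arg_mul (Complex.exp_ne_zero _) (fun h => hre.ne' (by rw [h]; rfl)), harge]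
    rw [abs_lt] at hargw
    rw [harge]
    constructor <;> nlinarith
  rw [harg, show Real.pi * (t - 1 / 2) + w.arg + Real.pi * (1 / 2 - t) = w.arg by ring]
  have him : |w.im| ≤ δ := by
    simp only [hw]
    rw [abs_mul, abs_of_pos (by linarith : 0 < 1 - R)]
    nlinarith [Real.abs_cos_le_one (Real.pi * t), abs_nonneg (Real.cos (Real.pi * t))]
  have key : ∀ s : ℝ, 0 < s → s ≤ 1 / 2 → Real.sin (Real.pi * t) = Real.sin (Real.pi * s) →
      |w.arg| ≤ 4 * δ / (δ + s) := by
    intro s hs0 hs1 hs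
    refine abs_arg_le_of_re_pos hre hδ0.le hs0 ?_
    have h1 : 2 * s ≤ Real.sin (Real.pi * s) := by
      have := Real.mul_le_sin (x := Real.pi * s) (by positivity) (by nlinarith)
      convert this using 1
      field_simp
    have h2 : s ≤ w.re := by
      simp only [hw]
      nlinarith
    calc s * |w.im| ≤ w.re * δ := by gcongr
      _ = δ * w.re := mul_comm _ _
  have hp1 : 0 ≤ 4 * δ / (δ + t) := by positivity
  have hp2 : 0 ≤ 4 * δ / (δ + (1 - t)) := div_nonneg (by linarith) (by linarith)
  rcases le_total t (1 / 2) with h | h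
  · linarith [key t ht0 h rfl]
  · have := key (1 - t) (by linarith) (by linarith) (by
      rw [mul_sub, mul_one, Real.sin_pi_sub])
    linarith

/-- The sawtooth function, the periodic extension of `1/2 - t` from `[0, 1)`. -/
noncomputable def sawtooth (t : ℝ) : ℝ := 1 / 2 - Int.fract t

lemma sawtooth_periodic : Function.Periodic sawtooth 1 := by
  intro t; rw [sawtooth, Int.fract_add_one, sawtooth]

lemma measurable_sawtooth : Measurable sawtooth := by
  unfold sawtooth; exact measurable_const.sub measurable_fract

lemma abs_sawtooth_le (t : ℝ) : |sawtooth t| ≤ 1 := by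
  have h1 := Int.fract_nonneg t
  have h2 := Int.fract_lt_one t
  rw [sawtooth, abs_le]; constructor <;> linarith

lemma intervalIntegrable_of_measurable_of_abs_le {f : ℝ → ℝ} (hf : Measurable f) {B : ℝ}
    (hB : ∀ t, |f t| ≤ B) (a b : ℝ) : IntervalIntegrable f MeasureTheory.volume a b := by
  rw [intervalIntegrable_iff]
  exact MeasureTheory.Measure.integrableOn_of_bounded (M := B) (by simp) hf.aestronglyMeasurable
    (by simpa using Filter.Eventually.of_forall fun t => hB t)

lemma continuous_arg_one_sub {R : ℝ} (hR0 : 0 ≤ R) (hR1 : R < 1) :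
    Continuous fun t => (1 - (R : ℂ) * circlePoint t).arg := by
  have hc := continuous_circlePoint
  rw [continuous_iff_continuousAt]
  intro t
  refine ContinuousAt.comp (Complex.continuousAt_arg ?_) (by fun_prop)
  left
  have : (R * circlePoint t).re ≤ R := by
    refine (Complex.re_le_norm _).trans ?_
    simp [abs_of_nonneg hR0]
  rw [Complex.sub_re, Complex.one_re]
  linarith

/-- The cost of leaving the boundary is of order `δ log (1/δ)` per root; with `δ = 2/n` and `n`
roots it adds up to `O(log n)`. -/
lemma integral_abs_sawtooth_add_arg_le {R δ : ℝ} (hR0 : 0 ≤ R) (hR1 : R < 1) (hδ : 1 - R ≤ δ) :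
    ∫ t in (0 : ℝ)..1, |sawtooth t + (1 - (R : ℂ) * circlePoint t).arg / Real.pi| ≤
      8 * δ * Real.log ((δ + 1) / δ) / Real.pi := by
  have hδ0 : 0 < δ := by linarith
  have hpi := Real.pi_pos
  have hcont := continuous_arg_one_sub hR0 hR1
  have hmeas : Measurable fun t => |sawtooth t + (1 - (R : ℂ) * circlePoint t).arg / Real.pi| :=
    (measurable_sawtooth.add (hcont.measurable.div_const _)).abs
  have hint1 : IntervalIntegrable (fun t => 4 * δ / (δ + t)) MeasureTheory.volume 0 1 := by
    refine ContinuousOn.intervalIntegrable (ContinuousOn.div (by fun_prop) (by fun_prop) ?_)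
    intro t ht
    rw [Set.uIcc_of_le zero_le_one] at ht
    linarith [ht.1]
  have hint2 : IntervalIntegrable (fun t => 4 * δ / (δ + (1 - t))) MeasureTheory.volume 0 1 := by
    refine ContinuousOn.intervalIntegrable (ContinuousOn.div (by fun_prop) (by fun_prop) ?_)
    intro t ht
    rw [Set.uIcc_of_le zero_le_one] at ht
    linarith [ht.2]
  have hI1 : ∫ t in (0 : ℝ)..1, 4 * δ / (δ + t) = 4 * δ * Real.log ((δ + 1) / δ) := by
    have h := intervalIntegral.integral_comp_add_left (a := 0) (b := 1) (fun t => t⁻¹) δ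
    simp only [div_eq_mul_inv]
    rw [intervalIntegral.integral_const_mul, h, add_zero, integral_inv_of_pos hδ0 (by linarith),
      div_eq_mul_inv]
  have hI2 : ∫ t in (0 : ℝ)..1, 4 * δ / (δ + (1 - t)) = 4 * δ * Real.log ((δ + 1) / δ) := by
    have h := intervalIntegral.integral_comp_sub_left (a := 0) (b := 1)
      (fun t => 4 * δ / (δ + t)) 1
    rw [h, sub_self, sub_zero, hI1]
  calc ∫ t in (0 : ℝ)..1, |sawtooth t + (1 - (R : ℂ) * circlePoint t).arg / Real.pi|
      ≤ ∫ t in (0 : ℝ)..1, (4 * δ / (δ + t) + 4 * δ / (δ + (1 - t))) / Real.pi := by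
        refine intervalIntegral.integral_mono_on_of_le_Ioo zero_le_one ?_
          ((hint1.add hint2).div_const _) fun t ht => ?_
        · refine intervalIntegrable_of_measurable_of_abs_le hmeas (B := 2) (fun t => ?_) _ _
          rw [abs_abs]
          refine (abs_add_le _ _).trans ?_
          rw [abs_div, abs_of_pos hpi]
          have h1 := abs_sawtooth_le t
          have h2 : |(1 - (R : ℂ) * circlePoint t).arg| / Real.pi ≤ 1 := by
            rw [div_le_one hpi]; exact Complex.abs_arg_le_pi _
          linarith
        · have h := abs_arg_one_sub_add_le hR0 hR1 hδ ht.1 ht.2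
          rw [le_div_iff₀ hpi]
          refine le_trans (le_of_eq ?_) h
          rw [sawtooth, Int.fract_eq_self.2 ⟨ht.1.le, ht.2⟩]
          nth_rw 2 [← abs_of_pos hpi]
          rw [← abs_mul]
          congr 1
          field_simp
          ring
    _ = _ := by
        rw [intervalIntegral.integral_div, intervalIntegral.integral_add hint1 hint2, hI1, hI2]
        ring

/-! ### From the maximum of the polynomial to the sawtooth sum -/

/-- Maximum principle: on the unit circle each factor has the same modulus as `ζ - circlePoint (x
j)`. -/
lemma prod_norm_one_sub_le {x : ℕ → ℝ} {n : ℕ} {B : ℝ}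
    (hB : ∀ ζ : ℂ, ‖ζ‖ = 1 → ∏ j ∈ Finset.range n, ‖ζ - circlePoint (x j)‖ ≤ B)
    {z : ℂ} (hz : ‖z‖ ≤ 1) :
    ∏ j ∈ Finset.range n, ‖1 - z * conj (circlePoint (x j))‖ ≤ B := by
  have h := Complex.norm_le_of_forall_mem_frontier_norm_le (U := Metric.ball (0 : ℂ) 1)
    (f := fun z => ∏ j ∈ Finset.range n, (1 - z * conj (circlePoint (x j)))) (C := B)
    Metric.isBounded_ball (Differentiable.diffContOnCl (by fun_prop)) ?_ (z := z)
    (by rw [closure_ball _ one_ne_zero]; simpa using hz)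
  · simpa only [norm_prod] using h
  · intro ζ hζ
    rw [frontier_ball _ one_ne_zero, mem_sphere_zero_iff_norm] at hζ
    rw [norm_prod]
    refine le_trans (le_of_eq (Finset.prod_congr rfl fun j _ => ?_)) (hB ζ hζ)
    have h1 : circlePoint (x j) * conj (circlePoint (x j)) = 1 := by
      rw [Complex.mul_conj, Complex.normSq_eq_norm_sq]; simp
    rw [show 1 - ζ * conj (circlePoint (x j)) =
      -conj (circlePoint (x j)) * (ζ - circlePoint (x j)) by linear_combination -h1]
    rw [norm_mul, norm_neg, Complex.norm_conj, norm_circlePoint, one_mul]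

lemma one_le_of_prod_norm_sub_le {x : ℕ → ℝ} {n : ℕ} {B : ℝ}
    (hB : ∀ ζ : ℂ, ‖ζ‖ = 1 → ∏ j ∈ Finset.range n, ‖ζ - circlePoint (x j)‖ ≤ B) : 1 ≤ B := by
  simpa using prod_norm_one_sub_le hB (z := 0) (by simp)

lemma integral_abs_sum_sawtooth_le {x : ℕ → ℝ} {n : ℕ} (hn : 2 ≤ n) {B : ℝ}
    (hB : ∀ ζ : ℂ, ‖ζ‖ = 1 → ∏ j ∈ Finset.range n, ‖ζ - circlePoint (x j)‖ ≤ B) :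
    ∫ t in (0 : ℝ)..1, |∑ j ∈ Finset.range n, sawtooth (t - x j)| ≤
      6 * (Real.log B + 1) * Real.log (2 * n) := by
  have hB1 := one_le_of_prod_norm_sub_le hB
  have hlogB : 0 ≤ Real.log B := Real.log_nonneg hB1
  have hpi := Real.pi_gt_three
  have hn' : (2 : ℝ) ≤ n := by exact_mod_cast hn
  -- Both radii are taken equal to `ρ`, so the argument is evaluated at `ρ * ρ`, within `2 / n` of
  -- the boundary. This keeps both the kernel norm and the total boundary error of order `log n`.
  set ρ : ℝ := 1 - 1 / n with hρ
  have hinv : 1 / (n : ℝ) ≤ 1 / 2 := by gcongr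
  have hinv0 : 0 < 1 / (n : ℝ) := by positivity
  have hρ0 : 0 < ρ := by linarith
  have hρ1 : ρ < 1 := by linarith
  have hR0 : 0 ≤ ρ * ρ := by positivity
  have hR1 : ρ * ρ < 1 := by nlinarith
  have hδ : 1 - ρ * ρ ≤ 2 / n := by
    rw [hρ, show (2 : ℝ) / n = 2 * (1 / n) by ring]; nlinarith
  set F : ℂ → ℂ := fun z => ∑ j ∈ Finset.range n, Complex.log (1 - z * conj (circlePoint (x j)))
    with hFdef
  have hre1 : ∀ z ∈ Metric.ball (0 : ℂ) 1, ∀ j, 0 < (1 - z * conj (circlePoint (x j))).re := by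
    intro z hz j
    have hz' : ‖z‖ < 1 := by simpa using hz
    have h1 := Complex.re_le_norm (z * conj (circlePoint (x j)))
    rw [norm_mul, Complex.norm_conj, norm_circlePoint, mul_one] at h1
    rw [Complex.sub_re, Complex.one_re]
    linarith
  have hF : DifferentiableOn ℂ F (Metric.ball 0 1) := by
    refine DifferentiableOn.fun_sum fun j _ => ?_
    exact DifferentiableOn.clog (by fun_prop) fun z hz => Or.inl (hre1 z hz j)
  have hF0 : F 0 = 0 := by simp [hFdef]
  have hFre : ∀ z ∈ Metric.ball (0 : ℂ) 1, (F z).re ≤ Real.log B := by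
    intro z hz
    have hne : ∀ j ∈ Finset.range n, ‖1 - z * conj (circlePoint (x j))‖ ≠ 0 := fun j _ h => by
      rw [norm_eq_zero] at h
      have := hre1 z hz j
      rw [h] at this
      exact this.ne' rfl
    simp only [hFdef, Complex.re_sum, Complex.log_re]
    rw [← Real.log_prod hne]
    refine Real.log_le_log (Finset.prod_pos fun j hj => (norm_nonneg _).lt_of_ne' (hne j hj)) ?_
    exact prod_norm_one_sub_le hB (mem_ball_zero_iff.1 hz).le
  -- Taking logs factor by factor makes the imaginary part a sum of principal arguments, with no
  -- `2π` ambiguity.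
  have hFim : ∀ t, (F ((ρ * ρ : ℝ) * circlePoint t)).im =
      ∑ j ∈ Finset.range n, (1 - ((ρ * ρ : ℝ) : ℂ) * circlePoint (t - x j)).arg := by
    intro t
    simp only [hFdef, Complex.im_sum, Complex.log_im, mul_assoc, circlePoint_mul_conj]
  have hA := integral_abs_im_le hF hF0 hρ0 hρ1 hρ0.le hρ1
  have hAre := integral_abs_re_le hF hF0 hlogB hFre hρ0 hρ1
  have hcont := continuous_arg_one_sub hR0 hR1
  set f : ℝ → ℝ := fun t => |sawtooth t + (1 - ((ρ * ρ : ℝ) : ℂ) * circlePoint t).arg / Real.pi|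
    with hf
  have hfm : Measurable f :=
    (measurable_sawtooth.add (hcont.measurable.div_const _)).abs
  have hfb : ∀ t, |f t| ≤ 2 := by
    intro t
    simp only [hf, abs_abs]
    refine (abs_add_le _ _).trans ?_
    rw [abs_div, abs_of_pos Real.pi_pos]
    have h1 := abs_sawtooth_le t
    have h2 : |(1 - ((ρ * ρ : ℝ) : ℂ) * circlePoint t).arg| / Real.pi ≤ 1 := by
      rw [div_le_one Real.pi_pos]; exact Complex.abs_arg_le_pi _
    linarith
  have hfp : Function.Periodic f 1 := fun t => by
    simp only [hf, sawtooth_periodic t, circlePoint_periodic t]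
  have hfi : ∀ j, ∫ t in (0 : ℝ)..1, f (t - x j) = ∫ t in (0 : ℝ)..1, f t := by
    intro j
    rw [intervalIntegral.integral_comp_sub_right f]
    have := hfp.intervalIntegral_add_eq (0 - x j) 0
    rwa [zero_add, show 0 - x j + 1 = 1 - x j by ring] at this
  have hfint : ∀ j, IntervalIntegrable (fun t => f (t - x j)) MeasureTheory.volume 0 1 := fun j =>
    intervalIntegrable_of_measurable_of_abs_le (hfm.comp (measurable_id.sub_const _))
      (fun t => hfb _) _ _
  have hfsum : IntervalIntegrable (fun t => ∑ j ∈ Finset.range n, f (t - x j))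
      MeasureTheory.volume 0 1 := by
    have := IntervalIntegrable.sum (Finset.range n) (fun j _ => hfint j)
    rwa [Finset.sum_fn] at this
  have hS := integral_abs_sawtooth_add_arg_le hR0 hR1 hδ
  have himc : Continuous fun t => |(F ((ρ * ρ : ℝ) * circlePoint t)).im| := by
    simp only [hFim]
    exact (continuous_finsetSum _ fun j _ => hcont.comp (continuous_sub_right (x j))).abs
  have hsm : Measurable fun t => |∑ j ∈ Finset.range n, sawtooth (t - x j)| :=
    (Finset.measurable_fun_sum _ fun j _ =>
      measurable_sawtooth.comp (measurable_id.sub_const _)).abs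
  have hlog0 : 0 ≤ Real.log ((1 + ρ) / (1 - ρ)) / Real.pi := by
    refine div_nonneg (Real.log_nonneg ?_) Real.pi_pos.le
    rw [le_div_iff₀ (by linarith)]
    linarith
  have hlog1 : Real.log ((1 + ρ) / (1 - ρ)) ≤ Real.log (2 * n) := by
    refine Real.log_le_log (div_pos (by linarith) (by linarith)) ?_
    rw [div_le_iff₀ (by linarith), hρ]
    have : (2 : ℝ) * n * (1 - (1 - 1 / n)) = 2 := by field_simp; ring
    rw [this]; linarith
  have hlog2 : Real.log ((2 / n + 1) / (2 / n)) ≤ Real.log (2 * n) := by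
    refine Real.log_le_log (by positivity) ?_
    rw [div_le_iff₀ (by positivity)]
    have : (2 : ℝ) * n * (2 / n) = 4 := by field_simp; norm_num
    rw [this]
    have : (2 : ℝ) / n ≤ 1 := by rw [div_le_one (by linarith)]; exact hn'
    linarith
  have hL : 0 ≤ Real.log (2 * n) := Real.log_nonneg (by linarith)
  calc ∫ t in (0 : ℝ)..1, |∑ j ∈ Finset.range n, sawtooth (t - x j)|
      ≤ ∫ t in (0 : ℝ)..1, (|(F ((ρ * ρ : ℝ) * circlePoint t)).im| / Real.pi +
          ∑ j ∈ Finset.range n, f (t - x j)) := by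
        refine intervalIntegral.integral_mono_on zero_le_one ?_ ?_ fun t _ => ?_
        · refine intervalIntegrable_of_measurable_of_abs_le hsm (B := n) (fun t => ?_) _ _
          rw [abs_abs]
          refine (Finset.abs_sum_le_sum_abs _ _).trans
            ((Finset.sum_le_sum fun j _ => abs_sawtooth_le _).trans_eq ?_)
          simp
        · exact ((himc.intervalIntegrable _ _).div_const _).add hfsum
        · rw [hFim]
          have h1 : ∑ j ∈ Finset.range n, sawtooth (t - x j) =
              -((∑ j ∈ Finset.range n, (1 - ((ρ * ρ : ℝ) : ℂ) * circlePoint (t - x j)).arg) /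
                Real.pi) +
              ∑ j ∈ Finset.range n, (sawtooth (t - x j) +
                (1 - ((ρ * ρ : ℝ) : ℂ) * circlePoint (t - x j)).arg / Real.pi) := by
            rw [Finset.sum_add_distrib, Finset.sum_div]; ring
          rw [h1]
          refine (abs_add_le _ _).trans (add_le_add ?_ (Finset.abs_sum_le_sum_abs _ _))
          rw [abs_neg, abs_div, abs_of_pos Real.pi_pos]
    _ = (∫ t in (0 : ℝ)..1, |(F ((ρ * ρ : ℝ) * circlePoint t)).im|) / Real.pi +
          n * ∫ t in (0 : ℝ)..1, f t := by
        rw [intervalIntegral.integral_add ((himc.intervalIntegrable _ _).div_const _) hfsum,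
          intervalIntegral.integral_div,
          intervalIntegral.integral_finsetSum fun j _ => hfint j]
        simp only [hfi, Finset.sum_const, Finset.card_range, nsmul_eq_mul]
    _ ≤ (2 * (2 * Real.log B) * (Real.log (2 * n) / Real.pi)) / Real.pi +
          n * (8 * (2 / n) * Real.log (2 * n) / Real.pi) := by
        refine add_le_add ?_ ?_
        · gcongr
          refine hA.trans ?_
          have : 0 ≤ ∫ s in (0 : ℝ)..1, |(F (ρ * circlePoint s)).re| :=
            intervalIntegral.integral_nonneg zero_le_one fun _ _ => abs_nonneg _
          gcongr
        · refine mul_le_mul_of_nonneg_left (hS.trans ?_) (by linarith)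
          gcongr
    _ = (4 * Real.log B / Real.pi ^ 2 + 16 / Real.pi) * Real.log (2 * n) := by
        field_simp
        ring
    _ ≤ 6 * (Real.log B + 1) * Real.log (2 * n) := by
        refine mul_le_mul_of_nonneg_right ?_ hL
        have h1 : 4 * Real.log B / Real.pi ^ 2 ≤ 6 * Real.log B := by
          rw [div_le_iff₀ (by positivity)]
          nlinarith [mul_nonneg hlogB (sq_nonneg (Real.pi - 1))]
        have h2 : 16 / Real.pi ≤ 6 := by
          rw [div_le_iff₀ Real.pi_pos]; linarith
        linarith

/-! ### Discrepancy as a sawtooth sum -/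

lemma indicator_sub_eq_sawtooth {x t : ℝ} (hx : x ∈ Set.Icc (0 : ℝ) 1) (ht0 : 0 ≤ t) (ht1 : t < 1) :
    (if x ≤ t then (1 : ℝ) else 0) - t = sawtooth (t - x) + (1 / 2 - x) := by
  split_ifs with h
  · rw [sawtooth, Int.fract_eq_self.2 ⟨by linarith, by linarith [hx.1]⟩]; ring
  · have : Int.fract (t - x) = t - x + 1 := by
      rw [← Int.fract_add_one, Int.fract_eq_self]
      constructor <;> linarith [hx.2, not_le.1 h]
    rw [sawtooth, this]; ring

lemma card_filter_le_eq_sum (x : ℕ → ℝ) (n : ℕ) (t : ℝ) :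
    (((Finset.range n).filter (fun k => x k ≤ t)).card : ℝ) =
      ∑ k ∈ Finset.range n, if x k ≤ t then (1 : ℝ) else 0 := by
  rw [Finset.card_filter]; push_cast; rfl

lemma measurable_discrepancy (x : ℕ → ℝ) (n : ℕ) : Measurable (discrepancy x n) := by
  unfold discrepancy
  simp only [card_filter_le_eq_sum]
  refine ((Measurable.const_mul (Finset.measurable_fun_sum _ fun k _ => ?_) _).sub
    measurable_id).abs
  exact Measurable.ite measurableSet_Ici measurable_const measurable_const

lemma natCast_mul_discrepancy (x : ℕ → ℝ) (n : ℕ) (t : ℝ) :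
    (n : ℝ) * discrepancy x n t =
      |∑ k ∈ Finset.range n, ((if x k ≤ t then (1 : ℝ) else 0) - t)| := by
  rcases Nat.eq_zero_or_pos n with rfl | hn
  · simp
  have hn' : (0 : ℝ) < n := by exact_mod_cast hn
  rw [discrepancy, card_filter_le_eq_sum]
  nth_rw 1 [← abs_of_pos hn']
  rw [← abs_mul, Finset.sum_sub_distrib, Finset.sum_const, Finset.card_range, nsmul_eq_mul]
  congr 1
  field_simp

lemma natCast_mul_discrepancy_le (x : ℕ → ℝ) (n : ℕ) {t : ℝ} (ht : t ∈ Set.Icc (0 : ℝ) 1) :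
    (n : ℝ) * discrepancy x n t ≤ n := by
  rw [natCast_mul_discrepancy]
  refine (Finset.abs_sum_le_sum_abs _ _).trans ((Finset.sum_le_card_nsmul _ _ 1 fun k _ => ?_).trans
    (by simp))
  rw [abs_le]
  split_ifs <;> constructor <;> linarith [ht.1, ht.2]

lemma discrepancyL1_nonneg (x : ℕ → ℝ) (n : ℕ) : 0 ≤ discrepancyL1 x n :=
  intervalIntegral.integral_nonneg zero_le_one fun _ _ => abs_nonneg _

lemma natCast_mul_discrepancyL1 (x : ℕ → ℝ) (n : ℕ) :
    (n : ℝ) * discrepancyL1 x n = ∫ t in (0 : ℝ)..1, (n : ℝ) * discrepancy x n t := by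
  rw [discrepancyL1, intervalIntegral.integral_const_mul]
  congr 1
  refine intervalIntegral.integral_congr fun t _ => ?_
  simp [discrepancy]

lemma intervalIntegrable_natCast_mul_discrepancy (x : ℕ → ℝ) (n : ℕ) :
    IntervalIntegrable (fun t => (n : ℝ) * discrepancy x n t) MeasureTheory.volume 0 1 := by
  rw [intervalIntegrable_iff]
  refine MeasureTheory.Measure.integrableOn_of_bounded (M := n) (by simp)
    ((measurable_discrepancy x n).const_mul _).aestronglyMeasurable ?_
  refine (MeasureTheory.ae_restrict_mem measurableSet_uIoc).mono fun t ht => ?_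
  rw [Set.uIoc_of_le zero_le_one] at ht
  rw [Real.norm_of_nonneg (by unfold discrepancy; positivity)]
  exact natCast_mul_discrepancy_le x n ⟨ht.1.le, ht.2⟩

lemma natCast_mul_discrepancyL1_le (x : ℕ → ℝ) (n : ℕ) : (n : ℝ) * discrepancyL1 x n ≤ n := by
  rw [natCast_mul_discrepancyL1]
  refine (intervalIntegral.integral_mono_on zero_le_one
    (intervalIntegrable_natCast_mul_discrepancy x n) (by simp)
    fun t ht => natCast_mul_discrepancy_le x n ht).trans_eq ?_
  simp

/-- Comparison of the discrepancy with a sum of sawtooth functions. -/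
lemma natCast_mul_discrepancyL1_le_integral_sawtooth {x : ℕ → ℝ}
    (hx : ∀ k, x k ∈ Set.Icc (0 : ℝ) 1) {n l : ℕ} (hln : l ≤ n) (hnl : n ≤ l + 1)
    (hl : |∑ j ∈ Finset.range l, (1 / 2 - x j)| ≤ 1) :
    (n : ℝ) * discrepancyL1 x n ≤
      (∫ t in (0 : ℝ)..1, |∑ j ∈ Finset.range l, sawtooth (t - x j)|) + 2 := by
  have hsm : Measurable fun t => |∑ j ∈ Finset.range l, sawtooth (t - x j)| :=
    (Finset.measurable_fun_sum _ fun j _ =>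
      measurable_sawtooth.comp (measurable_id.sub_const _)).abs
  have hsi : IntervalIntegrable (fun t => |∑ j ∈ Finset.range l, sawtooth (t - x j)|)
      MeasureTheory.volume 0 1 := by
    refine intervalIntegrable_of_measurable_of_abs_le hsm (B := l) (fun t => ?_) _ _
    rw [abs_abs]
    refine (Finset.abs_sum_le_sum_abs _ _).trans
      ((Finset.sum_le_sum fun j _ => abs_sawtooth_le _).trans_eq ?_)
    simp
  rw [natCast_mul_discrepancyL1]
  refine (intervalIntegral.integral_mono_on_of_le_Ioo zero_le_one
    (intervalIntegrable_natCast_mul_discrepancy x n)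
    (hsi.add (intervalIntegrable_const (c := 2))) fun t ht => ?_).trans_eq ?_
  · rw [natCast_mul_discrepancy]
    have h1 : |∑ k ∈ Finset.range l, ((if x k ≤ t then (1 : ℝ) else 0) - t)| ≤
        |∑ j ∈ Finset.range l, sawtooth (t - x j)| + 1 := by
      rw [Finset.sum_congr rfl fun k _ => indicator_sub_eq_sawtooth (hx k) ht.1.le ht.2,
        Finset.sum_add_distrib]
      exact (abs_add_le _ _).trans (by gcongr)
    -- An odd `n` has one unpaired point, which contributes at most 1.
    rcases (by omega : n = l ∨ n = l + 1) with rfl | rfl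
    · linarith
    · rw [Finset.sum_range_succ]
      have h2 : |(if x l ≤ t then (1 : ℝ) else 0) - t| ≤ 1 := by
        rw [abs_le]
        split_ifs <;> constructor <;> linarith [ht.1, ht.2]
      exact (abs_add_le _ _).trans (by linarith)
  · rw [intervalIntegral.integral_add hsi (by simp)]
    simp

/-! ### Conjugate pairs and the mean of the angles -/

lemma sum_range_two_mul {M : Type*} [AddCommMonoid M] (f : ℕ → M) (n : ℕ) :
    ∑ j ∈ Finset.range (2 * n), f j = ∑ k ∈ Finset.range n, (f (2 * k) + f (2 * k + 1)) := by
  induction n with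
  | zero => simp
  | succ n ih =>
    rw [Finset.sum_range_succ, ← ih, show 2 * (n + 1) = 2 * n + 1 + 1 by ring,
      Finset.sum_range_succ, Finset.sum_range_succ, add_assoc]

lemma prod_range_two_mul {M : Type*} [CommMonoid M] (f : ℕ → M) (n : ℕ) :
    ∏ j ∈ Finset.range (2 * n), f j = ∏ k ∈ Finset.range n, (f (2 * k) * f (2 * k + 1)) := by
  induction n with
  | zero => simp
  | succ n ih =>
    rw [Finset.prod_range_succ, ← ih, show 2 * (n + 1) = 2 * n + 1 + 1 by ring,
      Finset.prod_range_succ, Finset.prod_range_succ, mul_assoc]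

/-- Conjugate points have `a + b` an integer in `[0, 2]`, and 0 or 2 forces the point 1. There the
angle may be 0 or 1, hence the exceptional bound. -/
lemma abs_one_sub_sub_le {a b : ℝ} (ha : a ∈ Set.Icc (0 : ℝ) 1) (hb : b ∈ Set.Icc (0 : ℝ) 1)
    (h : circlePoint b = conj (circlePoint a)) :
    |1 - a - b| ≤ if circlePoint a = 1 then 1 else 0 := by
  split_ifs with h1
  · rw [abs_le]; constructor <;> linarith [ha.1, ha.2, hb.1, hb.2]
  · have hcp : circlePoint (a + b) = 1 := by
      have h2 := circlePoint_mul_conj a (-b)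
      rw [sub_neg_eq_add] at h2
      rw [← h2]
      have h3 : circlePoint (-b) = circlePoint a := by
        have := circlePoint_mul_conj 0 b
        rw [h, Complex.conj_conj, zero_sub] at this
        rw [← this]
        simp [circlePoint]
      rw [h3, Complex.mul_conj, Complex.normSq_eq_norm_sq]
      simp
    rw [circlePoint, Complex.exp_eq_one_iff] at hcp
    obtain ⟨k, hk⟩ := hcp
    have hk' : a + b = k := by
      have : (2 * (Real.pi : ℂ) * Complex.I) ≠ 0 := Complex.two_pi_I_ne_zero
      have h3 : ((a + b : ℝ) : ℂ) = (k : ℂ) := by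
        apply mul_left_cancel₀ this
        rw [hk]; ring
      exact_mod_cast h3
    have hk0 : 0 ≤ k := by
      have : (0 : ℝ) ≤ k := by linarith [ha.1, hb.1]
      exact_mod_cast this
    have hk2 : k ≤ 2 := by
      have : (k : ℝ) ≤ 2 := by linarith [ha.2, hb.2]
      exact_mod_cast this
    interval_cases k
    · exfalso
      have : a = 0 := by push_cast at hk'; linarith [ha.1, hb.1]
      exact h1 (by simp [this, circlePoint])
    · push_cast at hk'
      rw [show 1 - a - b = 0 by linarith, abs_zero]
    · exfalso
      have : a = 1 := by push_cast at hk'; linarith [ha.2, hb.2]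
      exact h1 (by simp [this, circlePoint])

/-- Each pair cancels exactly except possibly one located at the point 1; `hone` says that at most
one such pair exists. -/
lemma abs_sum_half_sub_le {x : ℕ → ℝ} (hx : ∀ k, x k ∈ Set.Icc (0 : ℝ) 1)
    (hconj : ∀ k, circlePoint (x (2 * k + 1)) = conj (circlePoint (x (2 * k))))
    (hone : ∀ i j, i < j → circlePoint (x (2 * i)) = 1 → circlePoint (x (2 * j)) ≠ 1) (k : ℕ) :
    |∑ j ∈ Finset.range (2 * k), (1 / 2 - x j)| ≤ 1 := by
  classical
  rw [sum_range_two_mul]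
  calc |∑ i ∈ Finset.range k, (1 / 2 - x (2 * i) + (1 / 2 - x (2 * i + 1)))|
      ≤ ∑ i ∈ Finset.range k, |1 / 2 - x (2 * i) + (1 / 2 - x (2 * i + 1))| :=
        Finset.abs_sum_le_sum_abs _ _
    _ ≤ ∑ i ∈ Finset.range k, if circlePoint (x (2 * i)) = 1 then (1 : ℝ) else 0 := by
        refine Finset.sum_le_sum fun i _ => ?_
        have := abs_one_sub_sub_le (hx (2 * i)) (hx (2 * i + 1)) (hconj i)
        rwa [show 1 / 2 - x (2 * i) + (1 / 2 - x (2 * i + 1)) = 1 - x (2 * i) - x (2 * i + 1) by ring]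
    _ = (((Finset.range k).filter fun i => circlePoint (x (2 * i)) = 1).card : ℝ) := by
        rw [Finset.card_filter]; push_cast; rfl
    _ ≤ 1 := by
        norm_cast
        refine Finset.card_le_one.2 fun i hi j hj => ?_
        rw [Finset.mem_filter] at hi hj
        rcases lt_trichotomy i j with h | h | h
        · exact absurd hj.2 (hone i j h hi.2)
        · exact h
        · exact absurd hi.2 (hone j i h hj.2)

/-! ### Symmetric Leja sequences -/

section Leja

variable {m : ℕ} {w : Fin m → ℂ} {z : ℕ → ℂ} {x : ℕ → ℝ}

/-- The modulus of `p_{2k}` at the point `z_{2k+1}`. -/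
noncomputable def lejaMax (z : ℕ → ℂ) (k : ℕ) : ℝ := ‖(rootPoly z (2 * k)).eval (z (2 * k))‖

lemma norm_eval_rootPoly (z : ℕ → ℂ) (n : ℕ) (ζ : ℂ) :
    ‖(rootPoly z n).eval ζ‖ = ∏ j ∈ Finset.range n, ‖ζ - z j‖ := by
  simp [rootPoly, Polynomial.eval_prod, norm_prod]

lemma IsAngleSequence.eq_circlePoint (hx : IsAngleSequence z x) (k : ℕ) :
    z k = circlePoint (x k) := (hx k).2

lemma IsSymmetricLejaSequence.prod_le_lejaMax (hz : IsSymmetricLejaSequence w z)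
    (hx : IsAngleSequence z x) {k : ℕ} (hk : m ≤ k) (ζ : ℂ) (hζ : ‖ζ‖ = 1) :
    ∏ j ∈ Finset.range (2 * k), ‖ζ - circlePoint (x j)‖ ≤ lejaMax z k := by
  have h := hz.greedy_max k hk (show ζ ∈ Metric.sphere (0 : ℂ) 1 by simpa using hζ)
  simp only [← hx.eq_circlePoint]
  rw [← norm_eval_rootPoly]
  exact h

lemma IsSymmetricLejaSequence.one_le_lejaMax (hz : IsSymmetricLejaSequence w z)
    (hx : IsAngleSequence z x) {k : ℕ} (hk : m ≤ k) : 1 ≤ lejaMax z k :=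
  one_le_of_prod_norm_sub_le (hz.prod_le_lejaMax hx hk)

/-- Initial points are distinct, and a greedy point cannot be an earlier root because the maximum is
at least 1. -/
lemma IsSymmetricLejaSequence.ne_one_of_lt (hz : IsSymmetricLejaSequence w z)
    (hx : IsAngleSequence z x) (hw : Function.Injective w) {i j : ℕ} (hij : i < j)
    (hi : z (2 * i) = 1) : z (2 * j) ≠ 1 := by
  intro hj
  rcases lt_or_ge j m with h | h
  · have h1 := hz.init ⟨i, hij.trans h⟩
    have h2 := hz.init ⟨j, h⟩
    simp only [hi, hj] at h1 h2
    have := hw (h1.symm.trans h2)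
    rw [Fin.mk.injEq] at this
    omega
  · have h1 := hz.one_le_lejaMax hx h
    rw [lejaMax, norm_eval_rootPoly, Finset.prod_eq_zero (i := 2 * i)] at h1
    · linarith
    · rw [Finset.mem_range]; omega
    · rw [hi, hj, sub_self, norm_zero]

lemma IsSymmetricLejaSequence.natCast_mul_discrepancyL1_le (hz : IsSymmetricLejaSequence w z)
    (hx : IsAngleSequence z x) (hw : Function.Injective w) {n k : ℕ} (hk : m ≤ k) (hk1 : 1 ≤ k)
    (hln : 2 * k ≤ n) (hnl : n ≤ 2 * k + 1) :
    (n : ℝ) * discrepancyL1 x n ≤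
      6 * (Real.log (lejaMax z k) + 1) * Real.log (4 * k) + 2 := by
  have hsum := abs_sum_half_sub_le (x := x) (fun k => (hx k).1)
    (fun k => by rw [← hx.eq_circlePoint, ← hx.eq_circlePoint]; exact hz.conj_pair k)
    (fun i j hij => by
      rw [← hx.eq_circlePoint, ← hx.eq_circlePoint]; exact hz.ne_one_of_lt hx hw hij) k
  refine (natCast_mul_discrepancyL1_le_integral_sawtooth (fun k => (hx k).1) hln hnl hsum).trans ?_
  have := integral_abs_sum_sawtooth_le (by omega) (hz.prod_le_lejaMax hx hk)
  rw [show (2 : ℝ) * ((2 * k : ℕ) : ℝ) = 4 * k by push_cast; ring] at this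
  linarith

/-- On the unit circle `(ζ - a)(ζ - conj a) = ζ * (2 Re ζ - 2 Re a)`. -/
lemma lejaMax_eq_prod (hconj : ∀ k, z (2 * k + 1) = conj (z (2 * k))) (hnorm : ∀ k, ‖z k‖ = 1)
    (k : ℕ) : lejaMax z k = ∏ j ∈ Finset.range k,
      ‖(z (2 * k) + conj (z (2 * k))) - (z (2 * j) + conj (z (2 * j)))‖ := by
  have hone : ∀ k, z k * conj (z k) = 1 := fun k => by
    rw [Complex.mul_conj, Complex.normSq_eq_norm_sq, hnorm]; simp
  rw [lejaMax, norm_eval_rootPoly, prod_range_two_mul]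
  refine Finset.prod_congr rfl fun j _ => ?_
  rw [hconj, ← norm_mul, show (z (2 * k) - z (2 * j)) * (z (2 * k) - conj (z (2 * j))) =
    z (2 * k) * ((z (2 * k) + conj (z (2 * k))) - (z (2 * j) + conj (z (2 * j)))) by
      linear_combination hone (2 * j) - hone (2 * k), norm_mul, hnorm, one_mul]

lemma norm_add_conj_sub_le (hnorm : ∀ k, ‖z k‖ = 1) (i j : ℕ) :
    ‖(z i + conj (z i)) - (z j + conj (z j))‖ ≤ 4 := by
  have h : ∀ k, ‖z k + conj (z k)‖ ≤ 2 := fun k =>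
    (norm_add_le _ _).trans (by rw [Complex.norm_conj, hnorm]; norm_num)
  exact (norm_sub_le _ _).trans (by linarith [h i, h j])

/-- The factors with both indices at least `q` form a Vandermonde product. The others, against the
first `q` pairs, are at most 4 each and cost only `O(q N)` in the logarithm, so the initial points
are harmless. -/
lemma prod_lejaMax_le (hconj : ∀ k, z (2 * k + 1) = conj (z (2 * k))) (hnorm : ∀ k, ‖z k‖ = 1)
    (q N : ℕ) :
    ∏ k ∈ Finset.Ico q N, lejaMax z k ≤ 4 ^ (q * N) * ((N : ℝ) ^ N * 2 ^ N) := by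
  rw [Finset.prod_Ico_eq_prod_range]
  set n := N - q with hn
  set y : ℕ → ℂ := fun k => z (2 * k) + conj (z (2 * k)) with hy
  have hstep : ∀ k, lejaMax z (q + k) ≤
      4 ^ q * ∏ j ∈ Finset.range k, ‖y (q + k) - y (q + j)‖ := by
    intro k
    rw [lejaMax_eq_prod hconj hnorm, Finset.prod_range_add]
    refine mul_le_mul_of_nonneg_right ?_ (Finset.prod_nonneg fun _ _ => norm_nonneg _)
    refine (Finset.prod_le_prod (fun _ _ => norm_nonneg _)
      fun j _ => norm_add_conj_sub_le hnorm _ _).trans_eq ?_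
    simp
  have hfek := prod_norm_sub_le (fun k => z (2 * (q + k))) (fun k => hnorm _) n
  have hnN : n ≤ N := Nat.sub_le _ _
  calc ∏ k ∈ Finset.range n, lejaMax z (q + k)
      ≤ ∏ k ∈ Finset.range n, (4 ^ q * ∏ j ∈ Finset.range k, ‖y (q + k) - y (q + j)‖) :=
        Finset.prod_le_prod (fun _ _ => norm_nonneg _) fun k _ => hstep k
    _ = 4 ^ (q * n) * ∏ k ∈ Finset.range n, ∏ j ∈ Finset.range k, ‖y (q + k) - y (q + j)‖ := by
        rw [Finset.prod_mul_distrib, Finset.prod_const, Finset.card_range, pow_mul]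
    _ ≤ 4 ^ (q * n) * ((n.factorial : ℝ) * 2 ^ n) := by gcongr
    _ ≤ 4 ^ (q * N) * ((N : ℝ) ^ N * 2 ^ N) := by
        have h1 : (n.factorial : ℝ) ≤ (N : ℝ) ^ N := by
          exact_mod_cast (Nat.factorial_le hnN).trans N.factorial_le_pow
        have h2 : q * n ≤ q * N := Nat.mul_le_mul_left q hnN
        gcongr
        · norm_num
        · norm_num

lemma IsSymmetricLejaSequence.sum_log_lejaMax_le (hz : IsSymmetricLejaSequence w z)
    (hx : IsAngleSequence z x) {q : ℕ} (hq : m ≤ q) {N : ℕ} (hN : 1 ≤ N) :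
    ∑ k ∈ Finset.Ico q N, Real.log (lejaMax z k) ≤
      N * (Real.log N + Real.log 2 + q * Real.log 4) := by
  have hpos : ∀ k ∈ Finset.Ico q N, 0 < lejaMax z k := fun k hk =>
    zero_lt_one.trans_le (hz.one_le_lejaMax hx (hq.trans (Finset.mem_Ico.1 hk).1))
  have hN' : (0 : ℝ) < N := by exact_mod_cast hN
  rw [← Real.log_prod fun k hk => (hpos k hk).ne']
  have h := prod_lejaMax_le (z := z) hz.conj_pair
    (fun k => by rw [hx.eq_circlePoint, norm_circlePoint]) q N
  refine (Real.log_le_log (Finset.prod_pos hpos) h).trans_eq ?_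
  rw [Real.log_mul (by positivity) (by positivity), Real.log_mul (by positivity) (by positivity),
    Real.log_pow, Real.log_pow, Real.log_pow]
  push_cast
  ring

lemma IsSymmetricLejaSequence.sum_natCast_mul_discrepancyL1_le (hz : IsSymmetricLejaSequence w z)
    (hx : IsAngleSequence z x) (hw : Function.Injective w) {N : ℕ} (hN : m + 1 ≤ N) :
    ∑ n ∈ Finset.Icc 1 N, (n : ℝ) * discrepancyL1 x n ≤
      4 * ((m : ℝ) + 1) ^ 2 + 4 * N + 12 * Real.log (4 * N) *
        (N * (Real.log N + Real.log 2 + ((m : ℝ) + 1) * Real.log 4 + 1)) := by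
  set a : ℕ → ℝ := fun n => (n : ℝ) * discrepancyL1 x n with ha
  have ha0 : ∀ n, 0 ≤ a n := fun n => mul_nonneg n.cast_nonneg (discrepancyL1_nonneg x n)
  have hN' : (1 : ℝ) ≤ N := by exact_mod_cast (by omega : 1 ≤ N)
  have hlogN : 0 ≤ Real.log (4 * N) := Real.log_nonneg (by linarith)
  -- Enlarging the range to `2N` lets the terms be grouped as `2k, 2k + 1` with `k < N`; this only
  -- costs a constant factor.
  have h1 : ∑ n ∈ Finset.Icc 1 N, a n ≤ ∑ n ∈ Finset.range (2 * N), a n := by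
    refine Finset.sum_le_sum_of_subset_of_nonneg (fun n hn => ?_) fun n _ _ => ha0 n
    rw [Finset.mem_Icc] at hn
    rw [Finset.mem_range]
    omega
  refine h1.trans ?_
  -- Below `m + 1` the trivial bound `n * ‖D_n‖ ≤ n` is used. Cutting at `m + 1` instead of `m`
  -- ensures `k ≥ 1` even when `m = 0`.
  rw [sum_range_two_mul, ← Finset.sum_range_add_sum_Ico _ hN]
  have h2 : ∑ k ∈ Finset.range (m + 1), (a (2 * k) + a (2 * k + 1)) ≤ 4 * ((m : ℝ) + 1) ^ 2 := by
    refine (Finset.sum_le_card_nsmul _ _ (4 * ((m : ℝ) + 1)) fun k hk => ?_).trans_eq ?_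
    · have hk' : (k : ℝ) ≤ m := by exact_mod_cast Nat.lt_succ_iff.1 (Finset.mem_range.1 hk)
      have h3 := SymmetricLeja.natCast_mul_discrepancyL1_le x (2 * k)
      have h4 := SymmetricLeja.natCast_mul_discrepancyL1_le x (2 * k + 1)
      simp only [ha]
      push_cast at h3 h4 ⊢
      linarith
    · rw [Finset.card_range, nsmul_eq_mul]; push_cast; ring
  have h3 : ∑ k ∈ Finset.Ico (m + 1) N, (a (2 * k) + a (2 * k + 1)) ≤
      ∑ k ∈ Finset.Ico (m + 1) N,
        (12 * Real.log (4 * N) * (Real.log (lejaMax z k) + 1) + 4) := by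
    refine Finset.sum_le_sum fun k hk => ?_
    rw [Finset.mem_Ico] at hk
    have hmk : m ≤ k := by omega
    have h4 := hz.natCast_mul_discrepancyL1_le hx hw hmk (by omega) le_rfl (Nat.le_succ _)
    have h5 := hz.natCast_mul_discrepancyL1_le hx hw hmk (by omega) (Nat.le_succ _) le_rfl
    have h6 : 0 ≤ Real.log (lejaMax z k) := Real.log_nonneg (hz.one_le_lejaMax hx hmk)
    have hk0 : (0 : ℝ) < k := by exact_mod_cast (by omega : 0 < k)
    have h7 : Real.log (4 * k) ≤ Real.log (4 * N) := by
      refine Real.log_le_log (by positivity) ?_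
      have : (k : ℝ) ≤ N := by exact_mod_cast hk.2.le
      linarith
    have h8 : 6 * (Real.log (lejaMax z k) + 1) * Real.log (4 * k) ≤
      6 * (Real.log (lejaMax z k) + 1) * Real.log (4 * N) := by gcongr
    simp only [ha]
    linarith
  have h4 : ∑ k ∈ Finset.Ico (m + 1) N,
        (12 * Real.log (4 * N) * (Real.log (lejaMax z k) + 1) + 4) ≤
      12 * Real.log (4 * N) *
        (N * (Real.log N + Real.log 2 + ((m : ℝ) + 1) * Real.log 4 + 1)) + 4 * N := by
    have h5 := hz.sum_log_lejaMax_le hx (Nat.le_succ m) (by omega : 1 ≤ N)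
    have h6 : ((N - (m + 1) : ℕ) : ℝ) ≤ N := by exact_mod_cast Nat.sub_le _ _
    rw [Finset.sum_add_distrib, ← Finset.mul_sum, Finset.sum_add_distrib, Finset.sum_const,
      Finset.sum_const, Nat.card_Ico, nsmul_eq_mul, nsmul_eq_mul]
    push_cast at h5 ⊢
    have h7 : ∑ k ∈ Finset.Ico (m + 1) N, Real.log (lejaMax z k) + ((N - (m + 1) : ℕ) : ℝ) * 1 ≤
        N * (Real.log N + Real.log 2 + ((m : ℝ) + 1) * Real.log 4 + 1) := by linarith
    refine add_le_add (mul_le_mul_of_nonneg_left h7 (by positivity)) (by linarith)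
  linarith

end Leja

/-! ### Asymptotics and the final averaging -/

lemma eventually_sum_bound_le (m : ℕ) : ∀ᶠ N : ℕ in Filter.atTop,
    m + 1 ≤ N ∧ 4 * ((m : ℝ) + 1) ^ 2 + 4 * N + 12 * Real.log (4 * N) *
        (N * (Real.log N + Real.log 2 + ((m : ℝ) + 1) * Real.log 4 + 1)) ≤
      50 * N * (Real.log N) ^ 2 := by
  have hlim : Filter.Tendsto (fun N : ℕ => Real.log N) Filter.atTop Filter.atTop :=
    Real.tendsto_log_atTop.comp tendsto_natCast_atTop_atTop
  filter_upwards [Filter.eventually_ge_atTop (m + 1),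
    hlim.eventually_ge_atTop (4 * ((m : ℝ) + 1) ^ 2 + 2 * (m + 1) + 4)] with N hN hL
  refine ⟨hN, ?_⟩
  set L := Real.log N
  have hN' : (1 : ℝ) ≤ N := by exact_mod_cast (by omega : 1 ≤ N)
  have hm : (0 : ℝ) ≤ m := m.cast_nonneg
  have hlog2 : Real.log 2 ≤ 1 := by linarith [Real.log_two_lt_d9]
  have hlog4 : Real.log 4 ≤ 2 := by
    rw [show (4 : ℝ) = 2 ^ 2 by norm_num, Real.log_pow]; push_cast; linarith
  have hlog2' : 0 ≤ Real.log 2 := Real.log_nonneg (by norm_num)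
  have hlog4' : 0 ≤ Real.log 4 := Real.log_nonneg (by norm_num)
  have hsq : 0 ≤ 4 * ((m : ℝ) + 1) ^ 2 := by positivity
  have hL4 : 4 ≤ L := by linarith
  have h1 : Real.log (4 * N) ≤ 2 * L := by
    rw [Real.log_mul (by norm_num) (by linarith)]; linarith
  have h2 : L + Real.log 2 + ((m : ℝ) + 1) * Real.log 4 + 1 ≤ 2 * L := by
    have : ((m : ℝ) + 1) * Real.log 4 ≤ (m + 1) * 2 := by gcongr
    linarith
  -- The main term is `48 N L²`; the remaining terms are absorbed by the slack up to 50.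
  have h3 : 12 * Real.log (4 * N) *
        (N * (L + Real.log 2 + ((m : ℝ) + 1) * Real.log 4 + 1)) ≤
      12 * (2 * L) * (N * (2 * L)) := by gcongr
  have h4 : 4 * ((m : ℝ) + 1) ^ 2 + 4 * N ≤ N * L := by nlinarith
  have h5 : N * L ≤ N * L ^ 2 := by
    gcongr; nlinarith
  nlinarith

end SymmetricLeja

theorem theorem1 :
    ∃ C : ℝ, 0 < C ∧
      ∀ (m : ℕ) (w : Fin m → ℂ), Function.Injective w → (∀ k, ‖w k‖ = 1) →
        (∀ᶠ N : ℕ in Filter.atTop, ∀ (z : ℕ → ℂ) (x : ℕ → ℝ),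
          SymmetricLeja.IsSymmetricLejaSequence w z → SymmetricLeja.IsAngleSequence z x →
            (1 / (N : ℝ)) * ∑ n ∈ Finset.Icc 1 N, (n : ℝ) * SymmetricLeja.discrepancyL1 x n
              ≤ C * (Real.log N) ^ 2) ∧
        (∀ K : ℝ, 0 < K →
          ∀ᶠ N : ℕ in Filter.atTop, ∀ (z : ℕ → ℂ) (x : ℕ → ℝ),
            SymmetricLeja.IsSymmetricLejaSequence w z → SymmetricLeja.IsAngleSequence z x →
              (((Finset.Icc 1 N).filter (fun n : ℕ =>
                  K * ((Real.log n) ^ 2 / (n : ℝ)) < SymmetricLeja.discrepancyL1 x n)).card : ℝ)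
                ≤ (C / K) * (N : ℝ)) := by
  -- `250 = 50 + 200`: 50 counts the exceptional `n ≤ √N`, and 200 comes from Markov's inequality
  -- for `n > √N`.
  refine ⟨250, by norm_num, fun m w hw _ => ⟨?_, fun K hK => ?_⟩⟩
  · filter_upwards [SymmetricLeja.eventually_sum_bound_le m] with N hN z x hz hx
    have h1 := (hz.sum_natCast_mul_discrepancyL1_le hx hw hN.1).trans hN.2
    have hN0 : (0 : ℝ) < N := by exact_mod_cast (by omega : 0 < N)
    rw [one_div, inv_mul_le_iff₀ hN0]
    nlinarith [mul_nonneg hN0.le (sq_nonneg (Real.log N))]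
  · have hlim : Filter.Tendsto (fun N : ℕ => Real.sqrt N) Filter.atTop Filter.atTop :=
      Real.tendsto_sqrt_atTop.comp tendsto_natCast_atTop_atTop
    filter_upwards [SymmetricLeja.eventually_sum_bound_le m, Filter.eventually_ge_atTop 2,
      hlim.eventually_ge_atTop (K / 50)] with N hN hN2 hNK z x hz hx
    have h1 := (hz.sum_natCast_mul_discrepancyL1_le hx hw hN.1).trans hN.2
    have hN1 : (1 : ℝ) < N := by exact_mod_cast (by omega : 1 < N)
    have hL : 0 < Real.log N := Real.log_pos hN1
    have hs0 : 0 < Real.sqrt N := Real.sqrt_pos.2 (by linarith)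
    set S := (Finset.Icc 1 N).filter (fun n : ℕ =>
      K * ((Real.log n) ^ 2 / (n : ℝ)) < SymmetricLeja.discrepancyL1 x n) with hS
    have hsplit := Finset.card_filter_add_card_filter_not (s := S) (fun n : ℕ => (n : ℝ) ≤ √N)
    have hsmall : ((S.filter fun n : ℕ => (n : ℝ) ≤ √N).card : ℝ) ≤ 50 / K * N := by
      have h2 : S.filter (fun n : ℕ => (n : ℝ) ≤ √N) ⊆ Finset.Icc 1 ⌊√N⌋₊ := by
        intro n hn
        rw [Finset.mem_filter, hS, Finset.mem_filter, Finset.mem_Icc] at hn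
        exact Finset.mem_Icc.2 ⟨hn.1.1.1, Nat.le_floor hn.2⟩
      have h3 : ((S.filter fun n : ℕ => (n : ℝ) ≤ √N).card : ℝ) ≤ √N := by
        have := Finset.card_le_card h2
        rw [Nat.card_Icc, Nat.add_sub_cancel] at this
        exact (Nat.cast_le.2 this).trans (Nat.floor_le hs0.le)
      refine h3.trans ?_
      have h4 : √(N : ℝ) * √N = N := Real.mul_self_sqrt (by linarith)
      rw [div_mul_eq_mul_div, le_div_iff₀ hK]
      nlinarith
    have hlarge : ((S.filter fun n : ℕ => ¬ (n : ℝ) ≤ √N).card : ℝ) ≤ 200 / K * N := by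
      have h2 : ((S.filter fun n : ℕ => ¬ (n : ℝ) ≤ √N).card : ℝ) *
          (K * (Real.log N) ^ 2 / 4) ≤
          ∑ n ∈ Finset.Icc 1 N, (n : ℝ) * SymmetricLeja.discrepancyL1 x n := by
        rw [← nsmul_eq_mul]
        refine (Finset.card_nsmul_le_sum _ (fun n : ℕ => (n : ℝ) * SymmetricLeja.discrepancyL1 x n)
          _ fun n hn => ?_).trans ?_
        · rw [Finset.mem_filter, hS, Finset.mem_filter, Finset.mem_Icc, not_le] at hn
          have hn0 : (0 : ℝ) < n := by exact_mod_cast (by omega : 0 < n)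
          -- Beyond `√N` the threshold `(log n)²` is at least `(log N)² / 4`, whence `200 = 4 * 50`.
          have h3 : Real.log N / 2 ≤ Real.log n := by
            rw [← Real.log_sqrt (by linarith)]
            exact Real.log_le_log hs0 hn.2.le
          have h4 : (Real.log N / 2) ^ 2 ≤ Real.log n ^ 2 := by gcongr
          have h5 : K * (Real.log n) ^ 2 ≤ n * SymmetricLeja.discrepancyL1 x n := by
            have := mul_le_mul_of_nonneg_left hn.1.2.le hn0.le
            refine le_trans (le_of_eq ?_) this
            field_simp
          have h6 := mul_le_mul_of_nonneg_left h4 hK.le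
          linarith
        · refine Finset.sum_le_sum_of_subset_of_nonneg (fun n hn => ?_) fun n _ _ =>
            mul_nonneg n.cast_nonneg (SymmetricLeja.discrepancyL1_nonneg x n)
          exact (Finset.mem_filter.1 (Finset.mem_filter.1 hn).1).1
      have h3 := h2.trans h1
      rw [div_mul_eq_mul_div, le_div_iff₀ hK]
      have hL2 : 0 < (Real.log N) ^ 2 / 4 := by positivity
      refine le_of_mul_le_mul_right ?_ hL2
      linarith
    have h2 : (S.card : ℝ) = ((S.filter fun n : ℕ => (n : ℝ) ≤ √N).card : ℝ) +
        ((S.filter fun n : ℕ => ¬ (n : ℝ) ≤ √N).card : ℝ) := by exact_mod_cast hsplit.symm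
    rw [h2, show (250 : ℝ) / K * N = 50 / K * N + 200 / K * N by ring]
    exact add_le_add hsmall hlarge
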